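/- Let $(\Omega,\mathcal A,\mu)$ be a probability space, $d,p$ natural numbers, $B>0$, and let $K_{kc}^B(\mathbb R^d)$ be the family of nonempty compact convex sets $K\subset\mathbb R^d$ with $\sup_{f\in K}\|f\|\le B$. Put $s(u,K)=\sup_{f\in K}\langle u,f\rangle$ for $u\in\mathbb S^{d-1}$ and $$d_{kc}(K,L)=\Big(\int_{\mathbb S^{d-1}}\{s(u,K)-s(u,L)\}^2\,du\Big)^{1/2},$$ where $du$ is surface measure. Let $X$ be a random element of a set $\mathcal X\subset\mathbb R^p$ and let $F:\Omega\to K_{kc}^B(\mathbb R^d)$ be a random set, i.e. $\{\omega: F(\omega)\cap C\neq\emptyset\}\in\mathcal A$ for every closed $C\subset\mathbb R^d$. A Fréchet mean of $F$ is a minimizer over $\nu\in K_{kc}^B(\mathbb R^d)$ of $\mathcal Q(\nu)=\mathbb E[d_{kc}^2(\nu,F)]$. A conditional Fréchet mean of $F$ given $X$ is a $\sigma(X)$-measurable random element $G$ of $K_{kc}^B(\mathbb R^d)$ such that almost surely $G$ minimizes over $\nu\in K_{kc}^B(\mathbb R^d)$ the function $\mathcal Q(\nu|X)=\mathbb E[d_{kc}^2(\nu,F)|X]$,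 the conditional expectations for the different $\nu$ being computed with one regular conditional distribution of $F$ given $X$. Let $\mathcal S^1(F)$ be the set of integrable random vectors $f$ with $f\in F$ almost surely. The Aumann mean is $\mathbb E[F]=\{\mathbb E[f]: f\in\mathcal S^1(F)\}$, and the conditional Aumann mean is the set $\mathbb E[F|X]=\{\mathbb E[f|X]: f\in\mathcal S^1(F)\}$ of $\sigma(X)$-measurable random vectors; a $\sigma(X)$-measurable random set $G$ is said to equal $\mathbb E[F|X]$ if the set of its integrable $\sigma(X)$-measurable selections (random vectors $g$ with $g\in G$ almost surely) is $\mathbb E[F|X]$. Then: (i) The Fréchet mean $\mathbb E_\oplus[F]$ exists and is unique, and the conditional Fréchet mean $\mathbb E_\oplus[F|X]$ exists and is almost surely unique: almost surely, $\mathcal Q(\cdot|X)$ has exactly one minimizer. (ii) $\mathbb E_\oplus[F]=\mathbb E[F]$. (iii) $\mathbb E_\oplus[F|X]=\mathbb E[F|X]$, and $\mathbb E_\oplus[F]=\mathbb E_\oplus[\mathbb E_\oplus[F|X]]$. -/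

import Mathlib

open MeasureTheory ProbabilityTheory TopologicalSpace
open scoped NNReal

noncomputable section

/-- The Euclidean space `ℝ^d`. -/
abbrev Euc (d : ℕ) : Type := EuclideanSpace ℝ (Fin d)

/-! ### Compact convex sets, support functions, and the metric -/

/-- The support function `s(p, K) = sup_{f ∈ K} ⟨p, f⟩` of a nonempty compact convex set `K`. -/
def supportFun {d : ℕ} (p : Euc d) (K : ConvexBody (Euc d)) : ℝ :=
  sSup ((fun f : Euc d => inner ℝ p f) '' (K : Set (Euc d)))

/-- The `L²` distance of support functions over the unit sphere, with respect to the surface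
measure of the sphere. -/
def dkc {d : ℕ} (K L : ConvexBody (Euc d)) : ℝ :=
  Real.sqrt (∫ p : Metric.sphere (0 : Euc d) 1,
    (supportFun (p : Euc d) K - supportFun (p : Euc d) L) ^ 2
      ∂((volume : Measure (Euc d)).toSphere))

/-- The nonempty compact convex subsets `K` of `ℝ^d` with `sup_{f ∈ K} ‖f‖ ≤ B`. -/
def KcB (d : ℕ) (B : ℝ≥0) : Type :=
  {K : ConvexBody (Euc d) // ∀ x ∈ K, ‖x‖ ≤ (B : ℝ)}

namespace KcB

variable {d : ℕ} {B : ℝ≥0}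

/-- The underlying nonempty compact convex set. -/
def body (K : KcB d B) : ConvexBody (Euc d) := K.1

/-- The underlying subset of `ℝ^d`. -/
def carrier (K : KcB d B) : Set (Euc d) := (K.body : Set (Euc d))

instance instNonempty : Nonempty (KcB d B) :=
  ⟨⟨0, fun x hx => by
    have h : x ∈ ((0 : ConvexBody (Euc d)) : Set (Euc d)) := hx
    rw [ConvexBody.coe_zero, Set.mem_zero] at h
    simp [h]⟩⟩

/-- The `σ`-algebra generated by the hitting events `{K | K ∩ C ≠ ∅}`, `C` closed: a map
`F : Ω → KcB d B` is measurable iff `{ω | F ω ∩ C ≠ ∅}` is an event for every closed `C`, which is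
the definition of a random closed set. -/
instance instMeasurableSpace : MeasurableSpace (KcB d B) :=
  MeasurableSpace.generateFrom
    {S | ∃ C : Set (Euc d), IsClosed C ∧ S = {K : KcB d B | (K.carrier ∩ C).Nonempty}}

/-- Measurability of a set-valued map, spelled out. -/
theorem measurable_iff {Ω : Type*} [MeasurableSpace Ω] (F : Ω → KcB d B) :
    Measurable F ↔
      ∀ C : Set (Euc d), IsClosed C → MeasurableSet {ω | ((F ω).carrier ∩ C).Nonempty} := by
  constructor
  · intro hF C hC
    exact hF (MeasurableSpace.measurableSet_generateFrom ⟨C, hC, rfl⟩)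
  · intro h
    refine measurable_generateFrom ?_
    rintro _ ⟨C, hC, rfl⟩
    exact h C hC

/-! The measurable space `KcB d B` is standard Borel, so that regular conditional distributions
of random compact convex sets exist. -/

/-- The inclusion into the space of all nonempty compact sets with the Hausdorff metric. -/
def toNonemptyCompacts (K : KcB d B) : NonemptyCompacts (Euc d) :=
  ⟨⟨K.carrier, K.body.isCompact⟩, K.body.nonempty⟩

theorem coe_toNonemptyCompacts (K : KcB d B) :
    (K.toNonemptyCompacts : Set (Euc d)) = K.carrier := rfl

theorem toNonemptyCompacts_injective :
    Function.Injective (toNonemptyCompacts : KcB d B → NonemptyCompacts (Euc d)) := by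
  intro K L h
  have h' : (K.toNonemptyCompacts : Set (Euc d)) = L.toNonemptyCompacts := by rw [h]
  exact Subtype.ext (ConvexBody.ext h')

theorem range_toNonemptyCompacts :
    Set.range (toNonemptyCompacts : KcB d B → NonemptyCompacts (Euc d)) =
      {K : NonemptyCompacts (Euc d) | Convex ℝ (K : Set (Euc d))} ∩
        {K : NonemptyCompacts (Euc d) | (K : Set (Euc d)) ⊆ Metric.closedBall 0 (B : ℝ)} := by
  ext K
  constructor
  · rintro ⟨L, rfl⟩
    exact ⟨L.body.convex, fun x hx => by simpa using L.2 x hx⟩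
  · rintro ⟨hc, hb⟩
    exact ⟨⟨⟨K, hc, K.isCompact, K.nonempty⟩, fun x hx => by simpa using hb hx⟩, rfl⟩

theorem isClosed_convex :
    IsClosed {K : NonemptyCompacts (Euc d) | Convex ℝ (K : Set (Euc d))} := by
  refine IsSeqClosed.isClosed ?_
  intro u K hu hK x hx y hy a b ha hb hab
  rw [← K.isCompact.isClosed.closure_eq]
  refine Metric.mem_closure_iff.2 fun ε hε => ?_
  obtain ⟨n, hn⟩ := ((Metric.tendsto_nhds.1 hK) (ε / 2) (by positivity)).exists
  rw [Metric.NonemptyCompacts.dist_eq] at hn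
  have hfin : Metric.hausdorffEDist (u n : Set (Euc d)) K ≠ ⊤ :=
    Metric.hausdorffEDist_ne_top_of_nonempty_of_bounded (u n).nonempty K.nonempty
      (u n).isCompact.isBounded K.isCompact.isBounded
  obtain ⟨x', hx', hxx⟩ := Metric.exists_dist_lt_of_hausdorffDist_lt' hx hn hfin
  obtain ⟨y', hy', hyy⟩ := Metric.exists_dist_lt_of_hausdorffDist_lt' hy hn hfin
  obtain ⟨z, hz, hzz⟩ :=
    Metric.exists_dist_lt_of_hausdorffDist_lt (hu n hx' hy' ha hb hab) hn hfin
  refine ⟨z, hz, ?_⟩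
  have h1 : dist (a • x + b • y) (a • x' + b • y') ≤ ε / 2 := by
    calc dist (a • x + b • y) (a • x' + b • y')
        ≤ dist (a • x) (a • x') + dist (b • y) (b • y') := dist_add_add_le _ _ _ _
      _ = a * dist x x' + b * dist y y' := by
          rw [dist_smul₀, dist_smul₀, Real.norm_of_nonneg ha, Real.norm_of_nonneg hb]
      _ ≤ a * (ε / 2) + b * (ε / 2) := by
          rw [dist_comm x x', dist_comm y y']
          gcongr
      _ = ε / 2 := by rw [← add_mul, hab, one_mul]
  calc dist (a • x + b • y) z
      ≤ dist (a • x + b • y) (a • x' + b • y') + dist (a • x' + b • y') z := dist_triangle _ _ _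
    _ < ε / 2 + ε / 2 := add_lt_add_of_le_of_lt h1 hzz
    _ = ε := by ring

/-- On nonempty compact sets, the hitting `σ`-algebra is the Borel `σ`-algebra of the Hausdorff
metric. -/
theorem borel_nonemptyCompacts :
    borel (NonemptyCompacts (Euc d)) = MeasurableSpace.generateFrom
      {S | ∃ C : Set (Euc d), IsClosed C ∧
        S = {K : NonemptyCompacts (Euc d) | ((K : Set (Euc d)) ∩ C).Nonempty}} := by
  have htop : (inferInstance : TopologicalSpace (NonemptyCompacts (Euc d))) =
      TopologicalSpace.generateFrom
        {S | ∃ U : Set (Euc d), IsOpen U ∧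
          (S = {K : NonemptyCompacts (Euc d) | (K : Set (Euc d)) ⊆ U} ∨
            S = {K : NonemptyCompacts (Euc d) | ((K : Set (Euc d)) ∩ U).Nonempty})} := by
    change TopologicalSpace.induced _ (TopologicalSpace.generateFrom _) = _
    rw [induced_generateFrom_eq]
    congr 1
    ext S
    constructor
    · rintro ⟨_, ⟨U, hU, rfl⟩ | ⟨U, hU, rfl⟩, rfl⟩
      · exact ⟨U, hU, Or.inl rfl⟩
      · exact ⟨U, hU, Or.inr rfl⟩
    · rintro ⟨U, hU, rfl | rfl⟩
      · exact ⟨_, Or.inl ⟨U, hU, rfl⟩, rfl⟩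
      · exact ⟨_, Or.inr ⟨U, hU, rfl⟩, rfl⟩
  refine le_antisymm ?_ ?_
  · rw [borel_eq_generateFrom_of_subbasis htop]
    refine MeasurableSpace.generateFrom_le ?_
    have hit : ∀ C : Set (Euc d), IsClosed C →
        MeasurableSet[MeasurableSpace.generateFrom
          {S | ∃ C : Set (Euc d), IsClosed C ∧
            S = {K : NonemptyCompacts (Euc d) | ((K : Set (Euc d)) ∩ C).Nonempty}}]
          {K : NonemptyCompacts (Euc d) | ((K : Set (Euc d)) ∩ C).Nonempty} :=
      fun C hC => MeasurableSpace.measurableSet_generateFrom ⟨C, hC, rfl⟩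
    rintro _ ⟨U, hU, rfl | rfl⟩
    · have h : {K : NonemptyCompacts (Euc d) | (K : Set (Euc d)) ⊆ U} =
          {K : NonemptyCompacts (Euc d) | ((K : Set (Euc d)) ∩ Uᶜ).Nonempty}ᶜ := by
        ext K
        simp [Set.inter_compl_nonempty_iff]
      rw [h]
      exact (hit _ hU.isClosed_compl).compl
    · obtain ⟨C, hC, -, hCU, -⟩ := hU.exists_iUnion_isClosed
      have h : {K : NonemptyCompacts (Euc d) | ((K : Set (Euc d)) ∩ U).Nonempty} =
          ⋃ n, {K : NonemptyCompacts (Euc d) | ((K : Set (Euc d)) ∩ C n).Nonempty} := by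
        ext K
        simp [← hCU, Set.inter_iUnion, Set.nonempty_iUnion]
      rw [h]
      exact MeasurableSet.iUnion fun n => hit _ (hC n)
  · refine MeasurableSpace.generateFrom_le ?_
    rintro _ ⟨C, hC, rfl⟩
    borelize (NonemptyCompacts (Euc d))
    exact (NonemptyCompacts.isClosed_inter_nonempty_of_isClosed hC).measurableSet

instance instStandardBorelSpace : StandardBorelSpace (KcB d B) := by
  let _ : TopologicalSpace (KcB d B) := TopologicalSpace.induced toNonemptyCompacts inferInstance
  have hemb : Topology.IsClosedEmbedding
      (toNonemptyCompacts : KcB d B → NonemptyCompacts (Euc d)) := by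
    refine ⟨⟨⟨rfl⟩, toNonemptyCompacts_injective⟩, ?_⟩
    rw [range_toNonemptyCompacts]
    exact isClosed_convex.inter
      (NonemptyCompacts.isClosed_subsets_of_isClosed Metric.isClosed_closedBall)
  have hpol : PolishSpace (KcB d B) := hemb.polishSpace
  have hbor : BorelSpace (KcB d B) := by
    refine ⟨?_⟩
    rw [borel_comap, borel_nonemptyCompacts, MeasurableSpace.comap_generateFrom]
    refine congrArg MeasurableSpace.generateFrom ?_
    ext S
    constructor
    · rintro ⟨C, hC, rfl⟩
      exact ⟨_, ⟨C, hC, rfl⟩, rfl⟩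
    · rintro ⟨_, ⟨C, hC, rfl⟩, rfl⟩
      exact ⟨C, hC, rfl⟩
  infer_instance

end KcB

/-! ### Regularity of the support function and of the metric -/

section Regularity

variable {d : ℕ} {B : ℝ≥0}

theorem bddAbove_inner_image (p : Euc d) (K : ConvexBody (Euc d)) :
    BddAbove ((fun f : Euc d => inner ℝ p f) '' (K : Set (Euc d))) :=
  (K.isCompact.image (by fun_prop)).bddAbove

theorem abs_supportFun_le (p : Euc d) (K : KcB d B) :
    |supportFun p K.body| ≤ ‖p‖ * B := by
  have hle : ∀ f ∈ K.carrier, |inner ℝ p f| ≤ ‖p‖ * B := fun f hf =>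
    (abs_real_inner_le_norm p f).trans (mul_le_mul_of_nonneg_left (K.2 f hf) (norm_nonneg p))
  refine abs_le.2 ⟨?_, ?_⟩
  · obtain ⟨f, hf⟩ := K.body.nonempty
    exact (abs_le.1 (hle f hf)).1.trans
      (le_csSup (bddAbove_inner_image p K.body) (Set.mem_image_of_mem _ hf))
  · refine csSup_le (K.body.nonempty.image _) ?_
    rintro _ ⟨f, hf, rfl⟩
    exact (abs_le.1 (hle f hf)).2

theorem supportFun_le_add (p q : Euc d) (K : KcB d B) :
    supportFun p K.body ≤ supportFun q K.body + B * dist p q := by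
  refine csSup_le (K.body.nonempty.image _) ?_
  rintro _ ⟨f, hf, rfl⟩
  have h1 : inner ℝ q f ≤ supportFun q K.body :=
    le_csSup (bddAbove_inner_image q K.body) (Set.mem_image_of_mem _ hf)
  have h2 : inner ℝ (p - q) f ≤ B * dist p q := by
    rw [dist_eq_norm, mul_comm]
    exact (real_inner_le_norm _ _).trans
      (mul_le_mul_of_nonneg_left (K.2 f hf) (norm_nonneg _))
  rw [inner_sub_left] at h2
  change inner ℝ p f ≤ _
  linarith

theorem continuous_supportFun (K : KcB d B) : Continuous fun p : Euc d => supportFun p K.body :=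
  (LipschitzWith.of_le_add_mul B fun p q => supportFun_le_add p q K).continuous

theorem measurable_supportFun (p : Euc d) :
    Measurable fun K : KcB d B => supportFun p K.body := by
  refine measurable_of_Ici fun c => ?_
  have hcl : IsClosed {f : Euc d | c ≤ inner ℝ p f} :=
    isClosed_le continuous_const (by fun_prop)
  have h : (fun K : KcB d B => supportFun p K.body) ⁻¹' Set.Ici c =
      {K : KcB d B | (K.carrier ∩ {f : Euc d | c ≤ inner ℝ p f}).Nonempty} := by
    ext K
    constructor
    · intro hK
      have hmem := (K.body.isCompact.image (f := fun f : Euc d => inner ℝ p f)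
        (by fun_prop)).sSup_mem (K.body.nonempty.image _)
      obtain ⟨f, hf, hfe⟩ := hmem
      refine ⟨f, hf, ?_⟩
      change c ≤ inner ℝ p f
      rw [show inner ℝ p f = supportFun p K.body from hfe]
      exact hK
    · rintro ⟨f, hf, hcf⟩
      exact le_trans hcf (le_csSup (bddAbove_inner_image p K.body) (Set.mem_image_of_mem _ hf))
  rw [h]
  exact MeasurableSpace.measurableSet_generateFrom ⟨_, hcl, rfl⟩

theorem measurable_dkc_sq (ν : KcB d B) :
    Measurable fun K : KcB d B => dkc ν.body K.body ^ 2 := by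
  have hj : Measurable (Function.uncurry
      fun (p : Metric.sphere (0 : Euc d) 1) (K : KcB d B) => supportFun (p : Euc d) K.body) :=
    measurable_uncurry_of_continuous_of_measurable
      (fun K => (continuous_supportFun K).comp continuous_subtype_val)
      (fun p => measurable_supportFun (p : Euc d))
  have hν : Measurable fun p : Metric.sphere (0 : Euc d) 1 => supportFun (p : Euc d) ν.body :=
    ((continuous_supportFun ν).comp continuous_subtype_val).measurable
  have hm : Measurable fun z : KcB d B × Metric.sphere (0 : Euc d) 1 =>
      (supportFun (z.2 : Euc d) ν.body - supportFun (z.2 : Euc d) z.1.body) ^ 2 :=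
    ((hν.comp measurable_snd).sub (hj.comp measurable_swap)).pow_const 2
  have hi := (hm.stronglyMeasurable.integral_prod_right'
    (ν := (volume : Measure (Euc d)).toSphere)).measurable
  exact (hi.sqrt).pow_const 2

theorem dkc_sq_le (ν K : KcB d B) :
    dkc ν.body K.body ^ 2 ≤
      (2 * (B : ℝ)) ^ 2 * ((volume : Measure (Euc d)).toSphere).real Set.univ := by
  rw [dkc, Real.sq_sqrt (integral_nonneg fun p => sq_nonneg _)]
  have hb : ∀ p : Metric.sphere (0 : Euc d) 1,
      (supportFun (p : Euc d) ν.body - supportFun (p : Euc d) K.body) ^ 2 ≤ (2 * (B : ℝ)) ^ 2 := by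
    intro p
    have hp : ‖(p : Euc d)‖ = 1 := by simp
    have h1 := abs_le.1 (abs_supportFun_le (p : Euc d) ν)
    have h2 := abs_le.1 (abs_supportFun_le (p : Euc d) K)
    rw [hp, one_mul] at h1 h2
    exact sq_le_sq' (by linarith [h1.1, h2.2]) (by linarith [h1.2, h2.1])
  have hint := norm_integral_le_of_norm_le_const (μ := (volume : Measure (Euc d)).toSphere)
    (Filter.Eventually.of_forall fun p => (Real.norm_of_nonneg (sq_nonneg _)).trans_le (hb p))
  exact (le_abs_self _).trans hint

theorem integrable_dkc_sq {Ω : Type*} {mΩ : MeasurableSpace Ω} (μ : Measure Ω)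
    [IsFiniteMeasure μ] {F : Ω → KcB d B} (hF : Measurable F) (ν : KcB d B) :
    Integrable (fun ω => dkc ν.body (F ω).body ^ 2) μ :=
  Integrable.of_bound ((measurable_dkc_sq ν).comp hF).aestronglyMeasurable
    ((2 * (B : ℝ)) ^ 2 * ((volume : Measure (Euc d)).toSphere).real Set.univ)
    (Filter.Eventually.of_forall fun ω => by
      rw [Real.norm_of_nonneg (sq_nonneg _)]
      exact dkc_sq_le ν (F ω))

end Regularity

/-! ### Fréchet means -/

section Means

variable {Ω : Type*} {d : ℕ} {B : ℝ≥0}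

/-- The population Fréchet function `Q(ν) = E[d_kc²(ν, F)]`. -/
def frechetFun {mΩ : MeasurableSpace Ω} (μ : Measure Ω) (F : Ω → KcB d B) (ν : KcB d B) : ℝ :=
  ∫ ω, dkc ν.body (F ω).body ^ 2 ∂μ

/-- `ν` is a Fréchet mean of `F`: a minimizer of `Q` over `KcB d B`. -/
def IsFrechetMean {mΩ : MeasurableSpace Ω} (μ : Measure Ω) (F : Ω → KcB d B) (ν : KcB d B) :
    Prop :=
  IsMinOn (frechetFun μ F) Set.univ ν

variable {𝒳 : Type*} [MeasurableSpace 𝒳]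

/-- The conditional Fréchet function `Q(ν | X)(ω) = E[d_kc²(ν, F) | X](ω)`, computed with the
regular conditional distribution of `F` given `X`. -/
def condFrechetFun {mΩ : MeasurableSpace Ω} (μ : Measure Ω) [IsFiniteMeasure μ]
    (F : Ω → KcB d B) (X : Ω → 𝒳) (ν : KcB d B) (ω : Ω) : ℝ :=
  ∫ K, dkc ν.body K.body ^ 2 ∂(condDistrib F X μ (X ω))

/-- The `σ`-algebra `σ(X)` generated by `X`. -/
abbrev sigmaX (X : Ω → 𝒳) : MeasurableSpace Ω := MeasurableSpace.comap X inferInstance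

/-- For every `ν`, `Q(ν | X)` is a version of the conditional expectation `E[d_kc²(ν, F) | X]`. -/
theorem condFrechetFun_ae_eq {mΩ : MeasurableSpace Ω} (μ : Measure Ω) [IsFiniteMeasure μ]
    {F : Ω → KcB d B} (hF : Measurable F) {X : Ω → 𝒳} (hX : Measurable X) (ν : KcB d B) :
    condFrechetFun μ F X ν =ᵐ[μ] μ[fun ω => dkc ν.body (F ω).body ^ 2 | sigmaX X] :=
  (condExp_ae_eq_integral_condDistrib hX hF.aemeasurable
    (measurable_dkc_sq ν).stronglyMeasurable (integrable_dkc_sq μ hF ν)).symm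

/-- `G` is a conditional Fréchet mean of `F` given `X`: a `σ(X)`-measurable random element of
`KcB d B` which almost surely minimizes `ν ↦ Q(ν | X)`. -/
def IsCondFrechetMean {mΩ : MeasurableSpace Ω} (μ : Measure Ω) [IsFiniteMeasure μ]
    (F : Ω → KcB d B) (X : Ω → 𝒳) (G : Ω → KcB d B) : Prop :=
  Measurable[sigmaX X] G ∧
    ∀ᵐ ω ∂μ, IsMinOn (fun ν => condFrechetFun μ F X ν ω) Set.univ (G ω)

/-! ### Aumann means -/

/-- The integrable selections of `F` that are measurable with respect to `m`. -/
def integrableSelections (m : MeasurableSpace Ω) {mΩ : MeasurableSpace Ω} (μ : Measure Ω)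
    (F : Ω → KcB d B) : Set (Ω → Euc d) :=
  {f | Measurable[m] f ∧ Integrable f μ ∧ ∀ᵐ ω ∂μ, f ω ∈ (F ω).carrier}

/-- The Aumann mean `E[F] = {E[f] : f ∈ S¹(F)}`. -/
def aumannMean {mΩ : MeasurableSpace Ω} (μ : Measure Ω) (F : Ω → KcB d B) : Set (Euc d) :=
  {x | ∃ f ∈ integrableSelections mΩ μ F, x = ∫ ω, f ω ∂μ}

/-- The conditional Aumann mean `E[F | X] = {E[f | X] : f ∈ S¹(F)}`, as the set of all
(`σ(X)`-measurable versions of) conditional expectations of integrable selections of `F`. -/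
def condAumannMean {mΩ : MeasurableSpace Ω} (μ : Measure Ω) (F : Ω → KcB d B) (X : Ω → 𝒳) :
    Set (Ω → Euc d) :=
  {g | Measurable[sigmaX X] g ∧ ∃ f ∈ integrableSelections mΩ μ F, g =ᵐ[μ] μ[f | sigmaX X]}

end Means

end

/-! ### Support functions determine convex bodies -/

section SupportFunction

variable {d : ℕ} {B : ℝ≥0}

/-! Support functions turn the geometry of `KcB d B` into Hilbert space geometry: `dkc` is an L²
distance between functions, so Fréchet means should be averages of support functions. An average of
support functions is again sublinear and bounded by `B‖·‖`, hence by Hahn–Banach is the support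
function of a body M in the same class (`meanBody`). Expanding the square gives Q(ν) = d²(ν, M) +
Q(M) (`integral_dkc_sq`), so M is the only minimizer. Applied to the law of `F`, this gives the
Fréchet mean; applied to the conditional distributions, the conditional one. A conditional Fréchet
mean G then satisfies s(p, G) = E[s(p, F) | X] almost surely for each p, and iterated expectations
reduce to the tower property.

For the Aumann identities, monotonicity of conditional expectation puts E[f | m] in G for every
selection f of `F`. Conversely, let g be an m-measurable selection of G, and let T f₀ be the point
nearest to g in L² among the conditional expectations of selections. The residual r = g - T f₀ is
m-measurable, and optimality bounds ⟨r, f⟩ by ⟨r, T f₀⟩ over all selections f. The supremum of ⟨r,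
f⟩ is E[s(r, F)] = E[s(r, G)] ≥ ⟨r, g⟩, so ‖r‖² ≤ 0 (`exists_condExp_eq_of_mem_carrier`). Taking m
trivial gives the unconditional identity. -/

theorem inner_le_supportFun (p : Euc d) (K : ConvexBody (Euc d)) {x : Euc d} (hx : x ∈ K) :
    inner ℝ p x ≤ supportFun p K :=
  le_csSup (bddAbove_inner_image p K) (Set.mem_image_of_mem _ hx)

theorem exists_inner_eq_supportFun (p : Euc d) (K : ConvexBody (Euc d)) :
    ∃ x ∈ K, inner ℝ p x = supportFun p K :=
  (K.isCompact.image (f := fun f : Euc d => inner ℝ p f) (by fun_prop)).sSup_mem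
    (K.nonempty.image _)

theorem supportFun_le_iff (p : Euc d) (K : ConvexBody (Euc d)) (c : ℝ) :
    supportFun p K ≤ c ↔ ∀ x ∈ K, inner ℝ p x ≤ c := by
  refine ⟨fun h x hx => (inner_le_supportFun p K hx).trans h, fun h => ?_⟩
  obtain ⟨x, hx, hxe⟩ := exists_inner_eq_supportFun p K
  exact hxe ▸ h x hx

theorem supportFun_add_le (p q : Euc d) (K : ConvexBody (Euc d)) :
    supportFun (p + q) K ≤ supportFun p K + supportFun q K := by
  refine (supportFun_le_iff _ _ _).2 fun x hx => ?_
  rw [inner_add_left]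
  exact add_le_add (inner_le_supportFun p K hx) (inner_le_supportFun q K hx)

theorem supportFun_smul {c : ℝ} (hc : 0 ≤ c) (p : Euc d) (K : ConvexBody (Euc d)) :
    supportFun (c • p) K = c * supportFun p K := by
  refine le_antisymm ((supportFun_le_iff _ _ _).2 fun x hx => ?_) ?_
  · rw [real_inner_smul_left]
    exact mul_le_mul_of_nonneg_left (inner_le_supportFun p K hx) hc
  · obtain ⟨x, hx, hxe⟩ := exists_inner_eq_supportFun p K
    rw [← hxe, ← real_inner_smul_left]
    exact inner_le_supportFun _ K hx

/-- A point outside `K` is strictly separated from it by a functional, whose Riesz vector is a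
direction violating the inequality. -/
theorem mem_convexBody_iff (K : ConvexBody (Euc d)) (x : Euc d) :
    x ∈ K ↔ ∀ p : Euc d, inner ℝ p x ≤ supportFun p K := by
  refine ⟨fun hx p => inner_le_supportFun p K hx, fun h => ?_⟩
  by_contra hx
  obtain ⟨l, u, hl, hu⟩ := geometric_hahn_banach_closed_point K.convex K.isCompact.isClosed hx
  obtain ⟨a, ha, hae⟩ := exists_inner_eq_supportFun ((InnerProductSpace.toDual ℝ (Euc d)).symm l) K
  have h1 := h ((InnerProductSpace.toDual ℝ (Euc d)).symm l)
  rw [← hae] at h1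
  simp only [InnerProductSpace.toDual_symm_apply] at h1
  linarith [hl a ha]

theorem ConvexBody.ext_supportFun {K L : ConvexBody (Euc d)}
    (h : ∀ p, supportFun p K = supportFun p L) : K = L := by
  refine ConvexBody.ext (Set.ext fun x => ?_)
  rw [SetLike.mem_coe, SetLike.mem_coe, mem_convexBody_iff, mem_convexBody_iff]
  simp only [h]

theorem KcB.ext_supportFun {K L : KcB d B}
    (h : ∀ p, supportFun p K.body = supportFun p L.body) : K = L :=
  Subtype.ext (ConvexBody.ext_supportFun h)

theorem KcB.ext_supportFun_sphere {K L : KcB d B}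
    (h : ∀ p : Metric.sphere (0 : Euc d) 1, supportFun (p : Euc d) K.body =
      supportFun (p : Euc d) L.body) : K = L := by
  refine KcB.ext_supportFun fun p => ?_
  rcases eq_or_ne p 0 with rfl | hp
  · have h0 (M : ConvexBody (Euc d)) : supportFun 0 M = 0 := by
      simpa using supportFun_smul le_rfl (0 : Euc d) M
    rw [h0, h0]
  · have hp' : ‖p‖ ≠ 0 := norm_ne_zero_iff.2 hp
    have hq := h ⟨‖p‖⁻¹ • p, by simp [norm_smul, hp']⟩
    have he : p = ‖p‖ • (‖p‖⁻¹ • p) := by rw [smul_smul, mul_inv_cancel₀ hp', one_smul]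
    rw [he, supportFun_smul (norm_nonneg p), supportFun_smul (norm_nonneg p), hq]

/-- Countably many directions suffice, so almost sure identities known direction by direction hold
simultaneously outside one null set. -/
theorem KcB.ext_supportFun_dense {K L : KcB d B}
    (h : ∀ n : ℕ, supportFun (denseSeq (Euc d) n) K.body = supportFun (denseSeq (Euc d) n) L.body) :
    K = L := by
  refine KcB.ext_supportFun fun p => ?_
  exact congrFun ((denseRange_denseSeq (Euc d)).equalizer (continuous_supportFun K)
    (continuous_supportFun L) (funext h)) p

theorem KcB.mem_carrier_of_dense {K : KcB d B} {x : Euc d}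
    (h : ∀ n : ℕ, inner ℝ (denseSeq (Euc d) n) x ≤ supportFun (denseSeq (Euc d) n) K.body) :
    x ∈ K.carrier := by
  refine (mem_convexBody_iff K.body x).2 fun p => ?_
  have hcl : IsClosed {p : Euc d | inner ℝ p x ≤ supportFun p K.body} :=
    isClosed_le (by fun_prop) (continuous_supportFun K)
  have := hcl.closure_subset_iff.2 (Set.range_subset_iff.2 h)
  exact this (denseRange_denseSeq (Euc d) p)

theorem measurable_uncurry_supportFun :
    Measurable fun z : Euc d × KcB d B => supportFun z.1 z.2.body :=
  measurable_uncurry_of_continuous_of_measurable (u := fun (p : Euc d) (K : KcB d B) =>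
    supportFun p K.body) continuous_supportFun measurable_supportFun

/-- By the Lusin–Souslin theorem, the `σ`-algebra of `KcB d B` is generated by the support
functions. -/
theorem KcB.measurable_of_supportFun {α : Type*} {mα : MeasurableSpace α} {N : α → KcB d B}
    (h : ∀ p, Measurable fun a => supportFun p (N a).body) : Measurable N := by
  have hemb : MeasurableEmbedding
      fun (K : KcB d B) (n : ℕ) => supportFun (denseSeq (Euc d) n) K.body :=
    (measurable_pi_lambda _ fun n => measurable_supportFun _).measurableEmbedding
      fun K L hKL => KcB.ext_supportFun_dense fun n => congrFun hKL n
  exact hemb.measurable_comp_iff.1 (measurable_pi_lambda _ fun n => h _)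

end SupportFunction

/-! ### The mean body as unique minimizer -/

section MeanBody

variable {d : ℕ} {B : ℝ≥0}

/-- A sublinear function bounded by `B ‖·‖` is the support function of a convex body. -/
theorem exists_supportFun_eq {s : Euc d → ℝ} (hs : ∀ c : ℝ, 0 < c → ∀ p, s (c • p) = c * s p)
    (hadd : ∀ p q, s (p + q) ≤ s p + s q) (hB : ∀ p, s p ≤ ‖p‖ * B) :
    ∃ K : KcB d B, ∀ p, supportFun p K.body = s p := by
  -- Homogeneity is assumed for positive factors only; the factor 2 yields the value at 0.
  have hs0 : s 0 = 0 := by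
    have := hs 2 two_pos 0
    rw [smul_zero] at this
    linarith
  -- Hahn–Banach, dominated by `s`: extending c • p ↦ c * s p gives a point touching the bound in
  -- direction `p`. The case p = 0 later supplies nonemptiness of the body.
  have hatt (p : Euc d) : ∃ x : Euc d, inner ℝ p x = s p ∧ ∀ q, inner ℝ q x ≤ s q := by
    rcases eq_or_ne p 0 with rfl | hp
    · obtain ⟨g, -, hg⟩ := exists_extension_of_le_sublinear (⟨⊥, 0⟩ : Euc d →ₗ.[ℝ] ℝ) s hs hadd (by
        rintro ⟨x, hx⟩
        obtain rfl : x = 0 := (Submodule.mem_bot ℝ).1 hx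
        exact hs0.ge)
      refine ⟨(InnerProductSpace.toDual ℝ (Euc d)).symm g.toContinuousLinearMap, ?_, fun q => ?_⟩
      · rw [inner_zero_left, hs0]
      · rw [real_inner_comm, InnerProductSpace.toDual_symm_apply]
        exact hg q
    · obtain ⟨g, hgp, hg⟩ := exists_extension_of_le_sublinear
        (LinearPMap.mkSpanSingleton p (s p) hp) s hs hadd (by
          rintro ⟨x, hx⟩
          obtain ⟨c, rfl⟩ := Submodule.mem_span_singleton.1 hx
          refine (LinearPMap.mkSpanSingleton'_apply p (s p) _ c hx).trans_le ?_
          rw [smul_eq_mul]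
          rcases lt_trichotomy c 0 with hc | rfl | hc
          -- Subadditivity gives 0 = s 0 ≤ s (c • p) + s (-c • p), which is the bound for negative
          -- `c`.
          · have h1 := hs (-c) (neg_pos.2 hc) p
            have h2 := hadd (c • p) ((-c) • p)
            rw [← add_smul, add_neg_cancel, zero_smul, hs0] at h2
            show c * s p ≤ s (c • p)
            linarith
          · simp [hs0]
          · exact (hs c hc p).ge)
      refine ⟨(InnerProductSpace.toDual ℝ (Euc d)).symm g.toContinuousLinearMap, ?_, fun q => ?_⟩
      · rw [real_inner_comm, InnerProductSpace.toDual_symm_apply]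
        exact (hgp ⟨p, Submodule.mem_span_singleton_self p⟩).trans
          (LinearPMap.mkSpanSingleton'_apply_self _ _ _ _)
      · rw [real_inner_comm, InnerProductSpace.toDual_symm_apply]
        exact hg q
  have hnorm : ∀ x ∈ {x : Euc d | ∀ p, inner ℝ p x ≤ s p}, ‖x‖ ≤ B := fun x hx => by
    rcases eq_or_ne x 0 with rfl | h0
    · simp
    · have h1 := (hx x).trans (hB x)
      rw [real_inner_self_eq_norm_sq, sq] at h1
      exact le_of_mul_le_mul_left h1 (norm_pos_iff.2 h0)
  have hclosed : IsClosed {x : Euc d | ∀ p, inner ℝ p x ≤ s p} := by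
    rw [Set.ofPred_forall]
    exact isClosed_iInter fun p => isClosed_le (by fun_prop) continuous_const
  have hconvex : Convex ℝ {x : Euc d | ∀ p, inner ℝ p x ≤ s p} := by
    rw [Set.ofPred_forall]
    exact convex_iInter fun p => convex_halfSpace_le
      (f := fun x : Euc d => inner ℝ p x) ⟨fun x y => inner_add_right _ _ _,
        fun c x => real_inner_smul_right _ _ _⟩ _
  let K : KcB d B := ⟨⟨{x | ∀ p, inner ℝ p x ≤ s p}, hconvex,
    (isCompact_closedBall (0 : Euc d) B).of_isClosed_subset hclosed fun x hx => by
      simpa using hnorm x hx,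
    (hatt 0).imp fun x hx => hx.2⟩, hnorm⟩
  refine ⟨K, fun p => le_antisymm ((supportFun_le_iff _ _ _).2 fun x hx => hx p) ?_⟩
  obtain ⟨x, hxe, hx⟩ := hatt p
  exact hxe ▸ inner_le_supportFun p K.body hx

theorem integrable_supportFun {Ω : Type*} {mΩ : MeasurableSpace Ω} (μ : Measure Ω)
    [IsFiniteMeasure μ] {F : Ω → KcB d B} (hF : Measurable F) (p : Euc d) :
    Integrable (fun ω => supportFun p (F ω).body) μ :=
  Integrable.of_bound ((measurable_supportFun p).comp hF).aestronglyMeasurable (‖p‖ * B)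
    (Filter.Eventually.of_forall fun ω => abs_supportFun_le p (F ω))

theorem integrable_supportFun_self (κ : Measure (KcB d B)) [IsFiniteMeasure κ] (p : Euc d) :
    Integrable (fun K : KcB d B => supportFun p K.body) κ :=
  integrable_supportFun κ measurable_id p

theorem exists_supportFun_eq_integral (κ : Measure (KcB d B)) [IsProbabilityMeasure κ] :
    ∃ M : KcB d B, ∀ p, supportFun p M.body = ∫ K, supportFun p K.body ∂κ := by
  refine exists_supportFun_eq (fun c hc p => ?_) (fun p q => ?_) (fun p => ?_)
  · simp only [supportFun_smul hc.le, integral_const_mul]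
  · rw [← integral_add (integrable_supportFun_self κ p)
      (integrable_supportFun_self κ q)]
    exact integral_mono (integrable_supportFun_self κ _)
      ((integrable_supportFun_self κ p).add (integrable_supportFun_self κ q))
      fun K => supportFun_add_le p q K.body
  · have h := norm_integral_le_of_norm_le_const (μ := κ)
      (f := fun K : KcB d B => supportFun p K.body) (Filter.Eventually.of_forall fun K : KcB d B => abs_supportFun_le p K)
    rw [probReal_univ, mul_one] at h
    exact (le_abs_self _).trans h

/-- The convex body whose support function is the mean of the support functions under `κ`. -/
noncomputable def meanBody (κ : Measure (KcB d B)) [IsProbabilityMeasure κ] : KcB d B :=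
  (exists_supportFun_eq_integral κ).choose

theorem supportFun_meanBody (κ : Measure (KcB d B)) [IsProbabilityMeasure κ] (p : Euc d) :
    supportFun p (meanBody κ).body = ∫ K, supportFun p K.body ∂κ :=
  (exists_supportFun_eq_integral κ).choose_spec p

theorem dkc_sq_eq (K L : KcB d B) : dkc K.body L.body ^ 2 =
    ∫ p : Metric.sphere (0 : Euc d) 1, (supportFun (p : Euc d) K.body -
      supportFun (p : Euc d) L.body) ^ 2 ∂((volume : Measure (Euc d)).toSphere) :=
  Real.sq_sqrt (integral_nonneg fun _ => sq_nonneg _)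

/-- The integrand is continuous and surface measure charges every nonempty open set of the sphere,
so vanishing almost everywhere means vanishing everywhere. -/
theorem eq_of_dkc_sq_eq_zero {K L : KcB d B} (h : dkc K.body L.body ^ 2 = 0) : K = L := by
  rw [dkc_sq_eq] at h
  have hcont : Continuous fun p : Metric.sphere (0 : Euc d) 1 =>
      (supportFun (p : Euc d) K.body - supportFun (p : Euc d) L.body) ^ 2 :=
    (((continuous_supportFun K).comp continuous_subtype_val).sub
      ((continuous_supportFun L).comp continuous_subtype_val)).pow 2
  have h0 := (hcont.ae_eq_iff_eq _ continuous_const).1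
    ((integral_eq_zero_iff_of_nonneg (fun _ => sq_nonneg _)
      (hcont.integrable_of_hasCompactSupport (HasCompactSupport.of_compactSpace _))).1 h)
  exact KcB.ext_supportFun_sphere fun p => sub_eq_zero.1 (pow_eq_zero_iff two_ne_zero |>.1
    (congrFun h0 p))

/-- The bias-variance decomposition of the Fréchet function. -/
theorem integral_dkc_sq (κ : Measure (KcB d B)) [IsProbabilityMeasure κ] (ν : KcB d B) :
    ∫ K, dkc ν.body K.body ^ 2 ∂κ =
      dkc ν.body (meanBody κ).body ^ 2 + ∫ K, dkc (meanBody κ).body K.body ^ 2 ∂κ := by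
  set σ := (volume : Measure (Euc d)).toSphere
  have hbound (p : Metric.sphere (0 : Euc d) 1) (K : KcB d B) :
      |supportFun (p : Euc d) K.body| ≤ B := by
    simpa using abs_supportFun_le (p : Euc d) K
  have hmeas : Measurable fun z : KcB d B × Metric.sphere (0 : Euc d) 1 =>
      supportFun (z.2 : Euc d) z.1.body :=
    measurable_uncurry_supportFun.comp
      ((measurable_subtype_coe.comp measurable_snd).prodMk measurable_fst)
  have hmeas1 (ν : KcB d B) : Measurable fun p : Metric.sphere (0 : Euc d) 1 =>
      supportFun (p : Euc d) ν.body :=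
    ((continuous_supportFun ν).comp continuous_subtype_val).measurable
  have hsq_le (ν K : KcB d B) (p : Metric.sphere (0 : Euc d) 1) :
      (supportFun (p : Euc d) ν.body - supportFun (p : Euc d) K.body) ^ 2 ≤ (2 * (B : ℝ)) ^ 2 := by
    have h1 := abs_le.1 (hbound p ν)
    have h2 := abs_le.1 (hbound p K)
    exact sq_le_sq' (by linarith [h1.1, h2.2]) (by linarith [h1.2, h2.1])
  have hint (ν : KcB d B) : Integrable (fun z : KcB d B × Metric.sphere (0 : Euc d) 1 =>
      (supportFun (z.2 : Euc d) ν.body - supportFun (z.2 : Euc d) z.1.body) ^ 2) (κ.prod σ) := by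
    refine Integrable.of_bound
      ((((hmeas1 ν).comp measurable_snd).sub hmeas).pow_const 2).aestronglyMeasurable
      ((2 * (B : ℝ)) ^ 2) (Filter.Eventually.of_forall fun z => ?_)
    rw [Real.norm_of_nonneg (sq_nonneg _)]
    exact hsq_le ν z.1 z.2
  -- Fubini reduces the decomposition to a scalar variance identity in each direction.
  have hswap (ν : KcB d B) : ∫ K, dkc ν.body K.body ^ 2 ∂κ = ∫ p, ∫ K,
      (supportFun (p : Euc d) ν.body - supportFun (p : Euc d) K.body) ^ 2 ∂κ ∂σ := by
    simp only [dkc_sq_eq]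
    exact integral_integral_swap (hint ν)
  rw [hswap, hswap, dkc_sq_eq, ← integral_add _ (hint _).integral_prod_right]
  · refine integral_congr_ae (Filter.Eventually.of_forall fun p => ?_)
    have hi := integrable_supportFun_self κ (p : Euc d)
    have hi2 : Integrable (fun K : KcB d B => (supportFun (p : Euc d) (meanBody κ).body -
        supportFun (p : Euc d) K.body) ^ 2) κ := by
      refine Integrable.of_bound
        ((measurable_const.sub (measurable_supportFun _)).pow_const 2).aestronglyMeasurable
        ((2 * (B : ℝ)) ^ 2) (Filter.Eventually.of_forall fun K => ?_)
      rw [Real.norm_of_nonneg (sq_nonneg _)]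
      exact hsq_le _ K p
    set a := supportFun (p : Euc d) ν.body
    have hm := supportFun_meanBody κ (p : Euc d)
    set b := supportFun (p : Euc d) (meanBody κ).body
    -- The cross term integrates to zero because `b` is the mean of the support functions in
    -- direction `p`.
    have hexp (K : KcB d B) : (a - supportFun (p : Euc d) K.body) ^ 2 =
        ((a - b) ^ 2 + 2 * (a - b) * (b - supportFun (p : Euc d) K.body)) +
          (b - supportFun (p : Euc d) K.body) ^ 2 := by ring
    have hi' : Integrable (fun K : KcB d B => 2 * (a - b) * (b - supportFun (p : Euc d) K.body)) κ :=
      ((integrable_const b).sub hi).const_mul _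
    have hc : Integrable (fun _ : KcB d B => (a - b) ^ 2) κ := integrable_const _
    change ∫ K : KcB d B, (a - supportFun (p : Euc d) K.body) ^ 2 ∂κ =
      (a - b) ^ 2 + ∫ K : KcB d B, (b - supportFun (p : Euc d) K.body) ^ 2 ∂κ
    rw [integral_congr_ae (Filter.Eventually.of_forall hexp)]
    rw [integral_add (f := fun K : KcB d B => (a - b) ^ 2 +
      2 * (a - b) * (b - supportFun (p : Euc d) K.body)) (hc.add hi') hi2, integral_add hc hi',
      integral_const_mul, integral_sub (integrable_const b) hi]
    rw [← hm]
    simp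
  · refine Integrable.of_bound (((hmeas1 _).sub (hmeas1 _)).pow_const 2).aestronglyMeasurable
      ((2 * (B : ℝ)) ^ 2) (Filter.Eventually.of_forall fun p => ?_)
    rw [Real.norm_of_nonneg (sq_nonneg _)]
    exact hsq_le _ _ p

theorem isMinOn_integral_dkc_sq_iff (κ : Measure (KcB d B)) [IsProbabilityMeasure κ]
    (ν : KcB d B) :
    IsMinOn (fun ν' : KcB d B => ∫ K, dkc ν'.body K.body ^ 2 ∂κ) Set.univ ν ↔
      ν = meanBody κ := by
  constructor
  · intro h
    have h1 := isMinOn_univ_iff.1 h (meanBody κ)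
    rw [integral_dkc_sq κ ν] at h1
    exact eq_of_dkc_sq_eq_zero (le_antisymm (by linarith) (sq_nonneg _))
  · rintro rfl
    refine isMinOn_univ_iff.2 fun ν' => ?_
    rw [integral_dkc_sq κ ν']
    linarith [sq_nonneg (dkc ν'.body (meanBody κ).body)]

end MeanBody

/-! ### Nearest points in linear images of bounded closed convex sets -/

section Hilbert

variable {E E' : Type*} [NormedAddCommGroup E] [InnerProductSpace ℝ E] [CompleteSpace E]
  [NormedAddCommGroup E'] [InnerProductSpace ℝ E']

/-- A decreasing sequence of nonempty bounded closed convex sets in a Hilbert space has nonempty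
intersection. -/
theorem nonempty_iInter_of_convex_isClosed {A : ℕ → Set E} (hanti : Antitone A)
    (hne : ∀ n, (A n).Nonempty) (hcl : ∀ n, IsClosed (A n)) (hconv : ∀ n, Convex ℝ (A n)) {R : ℝ}
    (hR : ∀ x ∈ A 0, ‖x‖ ≤ R) : (⋂ n, A n).Nonempty := by
  -- `x` is the point of least norm in `A n`; the obtuse-angle inequality controls distances by
  -- differences of squared norms.
  have hmin (n : ℕ) : ∃ x ∈ A n, ∀ y ∈ A n, ‖y - x‖ ^ 2 ≤ ‖y‖ ^ 2 - ‖x‖ ^ 2 := by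
    obtain ⟨x, hx, hxe⟩ := exists_norm_eq_iInf_of_complete_convex (hne n) (hcl n).isComplete
      (hconv n) 0
    refine ⟨x, hx, fun y hy => ?_⟩
    have h := (norm_eq_iInf_iff_real_inner_le_zero (hconv n) hx).1 hxe y hy
    rw [zero_sub, inner_neg_left, inner_sub_right, real_inner_self_eq_norm_sq,
      real_inner_comm] at h
    rw [norm_sub_sq_real]
    linarith
  choose x hx hxmin using hmin
  have hmono : Monotone fun n => ‖x n‖ ^ 2 := fun n k hnk => by
    have := hxmin n (x k) (hanti hnk (hx k))
    have h0 := sq_nonneg ‖x k - x n‖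
    change ‖x n‖ ^ 2 ≤ ‖x k‖ ^ 2
    linarith
  have hbdd : BddAbove (Set.range fun n => ‖x n‖ ^ 2) := by
    refine ⟨R ^ 2, Set.forall_mem_range.2 fun n => ?_⟩
    exact pow_le_pow_left₀ (norm_nonneg _) (hR _ (hanti (Nat.zero_le n) (hx n))) 2
  -- The squared norms increase and are bounded, so their convergence forces the minimal points to
  -- be Cauchy.
  have hcauchy : CauchySeq x := by
    refine Metric.cauchySeq_iff'.2 fun ε hε => ?_
    obtain ⟨N, hN⟩ := Metric.cauchySeq_iff'.1 (tendsto_atTop_ciSup hmono hbdd).cauchySeq (ε ^ 2)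
      (by positivity)
    refine ⟨N, fun n hn => ?_⟩
    have h1 := hxmin N (x n) (hanti hn (hx n))
    have h2 := (le_abs_self _).trans_lt (hN n hn)
    rw [dist_eq_norm]
    exact lt_of_pow_lt_pow_left₀ 2 hε.le (h1.trans_lt h2)
  obtain ⟨y, hy⟩ := cauchySeq_tendsto_of_complete hcauchy
  refine ⟨y, Set.mem_iInter.2 fun n => (hcl n).mem_of_tendsto hy ?_⟩
  filter_upwards [Filter.eventually_ge_atTop n] with k hk using hanti hk (hx k)

/-- A continuous linear image of a nonempty bounded closed convex set in a Hilbert space contains a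
point nearest to a given one. -/
theorem exists_nearest_in_image {C : Set E} (hne : C.Nonempty) (hcl : IsClosed C)
    (hconv : Convex ℝ C) {R : ℝ} (hR : ∀ x ∈ C, ‖x‖ ≤ R) (T : E →L[ℝ] E') (g : E') :
    ∃ x ∈ C, ∀ y ∈ C, inner ℝ (g - T x) (T y - T x) ≤ 0 := by
  have : Nonempty (T '' C) := (hne.image T).to_subtype
  set δ := ⨅ w : T '' C, ‖g - w‖ with hδ
  have hbdd : BddBelow (Set.range fun w : T '' C => ‖g - w‖) :=
    ⟨0, Set.forall_mem_range.2 fun _ => norm_nonneg _⟩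
  have hTconv : Convex ℝ (T '' C) := hconv.linear_image T.toLinearMap
  -- `T '' C` is not known to be closed, so the infimum is attained by working in the source: a
  -- point common to all these nested sets has image at distance `δ` from `g`.
  let A (n : ℕ) : Set E := C ∩ T ⁻¹' Metric.closedBall g (δ + 1 / ((n : ℝ) + 1))
  have hA : (⋂ n, A n).Nonempty := by
    refine nonempty_iInter_of_convex_isClosed (fun n k hnk => ?_) (fun n => ?_) (fun n => ?_)
      (fun n => ?_) fun x hx => hR x hx.1
    · exact Set.inter_subset_inter_right _ (Set.preimage_mono (Metric.closedBall_subset_closedBall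
        (by gcongr)))
    · obtain ⟨⟨_, x, hx, rfl⟩, hlt⟩ := exists_lt_of_ciInf_lt (lt_add_of_pos_right δ
        (Nat.one_div_pos_of_nat (α := ℝ) (n := n)))
      refine ⟨x, hx, ?_⟩
      rw [Set.mem_preimage, Metric.mem_closedBall, dist_comm, dist_eq_norm]
      exact hlt.le
    · exact hcl.inter (Metric.isClosed_closedBall.preimage T.continuous)
    · exact hconv.inter ((convex_closedBall _ _).linear_preimage T.toLinearMap)
  obtain ⟨x, hx⟩ := hA
  rw [Set.mem_iInter] at hx
  refine ⟨x, (hx 0).1, fun y hy => ?_⟩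
  refine (norm_eq_iInf_iff_real_inner_le_zero hTconv (Set.mem_image_of_mem T (hx 0).1)).1 ?_ _
    (Set.mem_image_of_mem T hy)
  refine le_antisymm ?_ (ciInf_le hbdd ⟨T x, Set.mem_image_of_mem T (hx 0).1⟩)
  have hlim : Filter.Tendsto (fun n : ℕ => δ + 1 / ((n : ℝ) + 1)) Filter.atTop (nhds (δ + 0)) :=
    tendsto_const_nhds.add tendsto_one_div_add_atTop_nhds_zero_nat
  rw [add_zero] at hlim
  refine ge_of_tendsto' hlim fun n => ?_
  have := (hx n).2
  rwa [Set.mem_preimage, Metric.mem_closedBall, dist_comm, dist_eq_norm] at this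

end Hilbert

/-! ### Metric projections as measurable selections -/

section Projection

variable {d : ℕ} {B : ℝ≥0}

theorem KcB.exists_proj (x : Euc d) (K : KcB d B) :
    ∃ y ∈ K.carrier, ∀ z ∈ K.carrier, inner ℝ (x - y) (z - y) ≤ 0 := by
  obtain ⟨y, hy, hye⟩ := exists_norm_eq_iInf_of_complete_convex K.body.nonempty
    K.body.isCompact.isComplete K.body.convex x
  exact ⟨y, hy, (norm_eq_iInf_iff_real_inner_le_zero K.body.convex hy).1 hye⟩

/-- The nearest point of `K` to `x`. -/
noncomputable def KcB.proj (x : Euc d) (K : KcB d B) : Euc d := (K.exists_proj x).choose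

theorem KcB.proj_mem (x : Euc d) (K : KcB d B) : K.proj x ∈ K.carrier :=
  (K.exists_proj x).choose_spec.1

theorem KcB.inner_sub_proj_le (x : Euc d) (K : KcB d B) {z : Euc d} (hz : z ∈ K.carrier) :
    inner ℝ (x - K.proj x) (z - K.proj x) ≤ 0 :=
  (K.exists_proj x).choose_spec.2 z hz

theorem KcB.norm_sq_add_norm_sq_le (x : Euc d) (K : KcB d B) {z : Euc d} (hz : z ∈ K.carrier) :
    ‖x - K.proj x‖ ^ 2 + ‖z - K.proj x‖ ^ 2 ≤ ‖x - z‖ ^ 2 := by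
  have h := K.inner_sub_proj_le x hz
  have he : x - z = (x - K.proj x) - (z - K.proj x) := by abel
  rw [he, norm_sub_sq_real (x - K.proj x)]
  linarith

/-- Adding the obtuse-angle inequalities at the two projections shows that the projection is
nonexpansive. -/
theorem KcB.continuous_proj (K : KcB d B) : Continuous fun x => K.proj x := by
  refine (LipschitzWith.of_dist_le_mul (K := 1) fun x y => ?_).continuous
  rw [NNReal.coe_one, one_mul, dist_eq_norm, dist_eq_norm]
  have h1 := K.inner_sub_proj_le x (K.proj_mem y)
  have h2 := K.inner_sub_proj_le y (K.proj_mem x)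
  have h3 := real_inner_le_norm (x - y) (K.proj x - K.proj y)
  have h4 : ‖K.proj x - K.proj y‖ ^ 2 = inner ℝ (x - y) (K.proj x - K.proj y) +
      (inner ℝ (x - K.proj x) (K.proj y - K.proj x) +
        inner ℝ (y - K.proj y) (K.proj x - K.proj y)) := by
    rw [← real_inner_self_eq_norm_sq]
    simp only [inner_sub_left, inner_sub_right]
    ring
  rcases eq_or_lt_of_le (norm_nonneg (K.proj x - K.proj y)) with h0 | h0
  · rw [← h0]
    exact norm_nonneg _
  · refine le_of_mul_le_mul_right ?_ h0
    nlinarith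

/-- The projection lies in a closed `C` exactly when, for every rational radius, `K` meets the ball
around `x` only if it does so inside `C`. This uses only hitting events, and makes projections of
random points onto a random set measurable selections. -/
theorem KcB.measurable_proj (x : Euc d) : Measurable fun K : KcB d B => K.proj x := by
  refine measurable_of_isClosed fun C hC => ?_
  have heq : (fun K : KcB d B => K.proj x) ⁻¹' C = ⋂ q : ℚ,
      ({K : KcB d B | (K.carrier ∩ Metric.closedBall x q).Nonempty}ᶜ ∪
        {K : KcB d B | (K.carrier ∩ (C ∩ Metric.closedBall x q)).Nonempty}) := by
    ext K
    simp only [Set.mem_preimage, Set.mem_iInter, Set.mem_union, Set.mem_compl_iff]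
    constructor
    · intro hK q
      refine or_iff_not_imp_left.2 fun hq => ?_
      obtain ⟨z, hz, hzq⟩ := not_not.1 hq
      refine ⟨K.proj x, K.proj_mem x, hK, ?_⟩
      rw [Metric.mem_closedBall, dist_comm, dist_eq_norm] at hzq ⊢
      have := K.norm_sq_add_norm_sq_le x hz
      exact (pow_le_pow_iff_left₀ (norm_nonneg _) (norm_nonneg _) two_ne_zero).1
        (by linarith [sq_nonneg ‖z - K.proj x‖]) |>.trans hzq
    · intro h
      have hq (q : ℚ) (hq : ‖x - K.proj x‖ < q) :
          (K.carrier ∩ (C ∩ Metric.closedBall x q)).Nonempty := by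
        refine (h q).resolve_left fun hn => hn ⟨K.proj x, K.proj_mem x, ?_⟩
        rw [Metric.mem_closedBall, dist_comm, dist_eq_norm]
        exact hq.le
      obtain ⟨q₀, hq₀⟩ := exists_rat_gt ‖x - K.proj x‖
      obtain ⟨z₀, hz₀, hz₀C, -⟩ := hq q₀ hq₀
      -- By compactness some `y` in K ∩ C is nearest to `x`; rational radii decreasing to the
      -- distance from `x` to `K` show that `y` is also nearest in `K`, hence is the projection.
      obtain ⟨y, ⟨hyK, hyC⟩, hy⟩ := (K.body.isCompact.inter_right hC).exists_isMinOn ⟨z₀, hz₀, hz₀C⟩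
        (f := fun z => dist z x) (by fun_prop)
      have hle : ‖x - y‖ ≤ ‖x - K.proj x‖ := by
        refine le_of_forall_gt_imp_ge_of_dense fun r hr => ?_
        obtain ⟨q, hq1, hq2⟩ := exists_rat_btwn hr
        obtain ⟨z, hzK, hzC, hz⟩ := hq q hq1
        rw [← dist_eq_norm, dist_comm]
        exact ((isMinOn_iff.1 hy z ⟨hzK, hzC⟩).trans (Metric.mem_closedBall.1 hz)).trans hq2.le
      have h1 := K.norm_sq_add_norm_sq_le x hyK
      have h2 := pow_le_pow_left₀ (norm_nonneg _) hle 2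
      have h3 : ‖y - K.proj x‖ ^ 2 = 0 := le_antisymm (by linarith) (sq_nonneg _)
      have h4 : y = K.proj x := sub_eq_zero.1 (norm_eq_zero.1 (pow_eq_zero_iff two_ne_zero |>.1 h3))
      exact h4 ▸ hyC
  rw [heq]
  refine MeasurableSet.iInter fun q => (MeasurableSet.compl ?_).union ?_
  · exact MeasurableSpace.measurableSet_generateFrom ⟨_, Metric.isClosed_closedBall, rfl⟩
  · exact MeasurableSpace.measurableSet_generateFrom ⟨_, hC.inter Metric.isClosed_closedBall, rfl⟩

theorem KcB.measurable_uncurry_proj : Measurable fun z : Euc d × KcB d B => z.2.proj z.1 :=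
  measurable_uncurry_of_continuous_of_measurable (u := fun (x : Euc d) (K : KcB d B) => K.proj x)
    KcB.continuous_proj KcB.measurable_proj

/-- Projections of far away points in direction `h` nearly maximize `⟨h, ·⟩`. -/
theorem supportFun_le_inner_proj (h : Euc d) (K : KcB d B) {t : ℝ} (ht : 0 < t) :
    supportFun h K.body ≤ inner ℝ h (K.proj (t • h)) + B ^ 2 / t := by
  refine (supportFun_le_iff _ _ _).2 fun y hy => ?_
  -- With π the projection, this expands to t⟨h, y - π⟩ ≤ ⟨π, y⟩ - ‖π‖² ≤ B².
  have h1 := K.inner_sub_proj_le (t • h) hy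
  have h2 : inner ℝ (K.proj (t • h)) y ≤ (B : ℝ) ^ 2 := by
    rw [sq]
    exact (real_inner_le_norm _ _).trans
      (mul_le_mul (K.2 _ (K.proj_mem _)) (K.2 y hy) (norm_nonneg _) B.2)
  have h3 : 0 ≤ inner ℝ (K.proj (t • h)) (K.proj (t • h)) := real_inner_self_nonneg
  rw [inner_sub_left, inner_sub_right, inner_sub_right, real_inner_smul_left,
    real_inner_smul_left] at h1
  rw [← sub_le_iff_le_add', le_div_iff₀ ht]
  linarith

end Projection

/-! ### Conditional expectations of selections -/

section Conditional

variable {Ω : Type*} {d : ℕ} {B : ℝ≥0}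

theorem ae_eq_meanBody_condDistrib {β : Type*} {mβ : MeasurableSpace β} {mΩ : MeasurableSpace Ω}
    (μ : Measure Ω) [IsProbabilityMeasure μ] {X : Ω → β} (hX : Measurable X) {F G : Ω → KcB d B}
    (hF : Measurable F)
    (hs : ∀ p, (fun ω => supportFun p (G ω).body) =ᵐ[μ]
      μ[fun ω => supportFun p (F ω).body | mβ.comap X]) :
    ∀ᵐ ω ∂μ, G ω = meanBody (condDistrib F X μ (X ω)) := by
  have h : ∀ᵐ ω ∂μ, ∀ n : ℕ, supportFun (denseSeq (Euc d) n) (G ω).body =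
      ∫ K, supportFun (denseSeq (Euc d) n) K.body ∂(condDistrib F X μ (X ω)) :=
    ae_all_iff.2 fun n => (hs _).trans (condExp_ae_eq_integral_condDistrib hX hF.aemeasurable
      (measurable_supportFun _).stronglyMeasurable (integrable_supportFun μ hF _))
  filter_upwards [h] with ω hω
  exact KcB.ext_supportFun_dense fun n => (hω n).trans (supportFun_meanBody _ _).symm

/-- The hypothesis concerns deterministic directions; disintegration along `X` extends it to
directions depending on `X`, since almost surely `G` is the mean body of the conditional
distribution. -/
theorem integral_supportFun_comp {β : Type*} {mβ : MeasurableSpace β} {mΩ : MeasurableSpace Ω}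
    (μ : Measure Ω) [IsProbabilityMeasure μ] {X : Ω → β} (hX : Measurable X) {F G : Ω → KcB d B}
    (hF : Measurable F)
    (hs : ∀ p, (fun ω => supportFun p (G ω).body) =ᵐ[μ]
      μ[fun ω => supportFun p (F ω).body | mβ.comap X])
    {h : β → Euc d} (hh : Measurable h) (hi : Integrable (fun ω => h (X ω)) μ) :
    ∫ ω, supportFun (h (X ω)) (F ω).body ∂μ = ∫ ω, supportFun (h (X ω)) (G ω).body ∂μ := by
  have hm : Measurable fun z : β × KcB d B => supportFun (h z.1) z.2.body :=
    measurable_uncurry_supportFun.comp ((hh.comp measurable_fst).prodMk measurable_snd)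
  have hint : Integrable (fun ω => supportFun (h (X ω)) (F ω).body) μ :=
    (hi.norm.mul_const (B : ℝ)).mono' (hm.comp (hX.prodMk hF)).aestronglyMeasurable
      (Filter.Eventually.of_forall fun ω => abs_supportFun_le _ _)
  rw [← integral_condExp hX.comap_le]
  refine integral_congr_ae ?_
  filter_upwards [condExp_prod_ae_eq_integral_condDistrib hX hF.aemeasurable hm.stronglyMeasurable
    hint, ae_eq_meanBody_condDistrib μ hX hF hs] with ω h1 h2
  rw [h1, h2, supportFun_meanBody]

theorem memLp_of_ae_mem {mΩ : MeasurableSpace Ω} {μ : Measure Ω} [IsFiniteMeasure μ]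
    {F : Ω → KcB d B} {f : Ω → Euc d} (hf : AEStronglyMeasurable f μ)
    (h : ∀ᵐ ω ∂μ, f ω ∈ (F ω).carrier) (q : ENNReal) : MemLp f q μ :=
  MemLp.of_bound hf B (h.mono fun ω hω => (F ω).2 _ hω)

/-- Conditioning ⟨p, f⟩ ≤ s(p, F) for a dense sequence of directions `p` bounds the conditional
expectation of `f` by the support function of `G`. -/
theorem condExp_mem_carrier {m mΩ : MeasurableSpace Ω} {μ : Measure Ω}
    [IsProbabilityMeasure μ] {F G : Ω → KcB d B} (hF : Measurable F)
    (hs : ∀ p, (fun ω => supportFun p (G ω).body) =ᵐ[μ] μ[fun ω => supportFun p (F ω).body | m])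
    {f : Ω → Euc d} (hf : Integrable f μ) (hfF : ∀ᵐ ω ∂μ, f ω ∈ (F ω).carrier) :
    ∀ᵐ ω ∂μ, (μ[f | m]) ω ∈ (G ω).carrier := by
  have h : ∀ᵐ ω ∂μ, ∀ n : ℕ, inner ℝ (denseSeq (Euc d) n) ((μ[f | m]) ω) ≤
      supportFun (denseSeq (Euc d) n) (G ω).body := by
    refine ae_all_iff.2 fun n => ?_
    have h1 := (innerSL ℝ (denseSeq (Euc d) n)).comp_condExp_comm (m := m) hf
    have h2 : μ[innerSL ℝ (denseSeq (Euc d) n) ∘ f | m] ≤ᵐ[μ]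
        μ[fun ω => supportFun (denseSeq (Euc d) n) (F ω).body | m] :=
      condExp_mono (ContinuousLinearMap.integrable_comp _ hf) (integrable_supportFun μ hF _)
        (hfF.mono fun ω hω => inner_le_supportFun _ _ hω)
    filter_upwards [h1, h2, hs (denseSeq (Euc d) n)] with ω h1 h2 h3
    rw [h3]
    exact (h1.le.trans h2)
  filter_upwards [h] with ω hω using KcB.mem_carrier_of_dense hω

/-- The square integrable selections of a random set. -/
def lpSelections {mΩ : MeasurableSpace Ω} (μ : Measure Ω) (F : Ω → KcB d B) :
    Set (Lp (Euc d) 2 μ) :=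
  {f | ∀ᵐ ω ∂μ, f ω ∈ (F ω).carrier}

theorem convex_lpSelections {mΩ : MeasurableSpace Ω} (μ : Measure Ω) (F : Ω → KcB d B) :
    Convex ℝ (lpSelections μ F) := by
  intro f hf g hg a b ha hb hab
  filter_upwards [hf, hg, Lp.coeFn_add (a • f) (b • g), Lp.coeFn_smul a f, Lp.coeFn_smul b g]
    with ω h1 h2 h3 h4 h5
  rw [h3, Pi.add_apply, h4, h5]
  exact (F ω).body.convex h1 h2 ha hb hab

theorem isClosed_lpSelections {mΩ : MeasurableSpace Ω} (μ : Measure Ω) (F : Ω → KcB d B) :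
    IsClosed (lpSelections μ F) := by
  refine IsSeqClosed.isClosed fun u f hu hf => ?_
  obtain ⟨ns, -, hns⟩ := (tendstoInMeasure_of_tendsto_Lp hf).exists_seq_tendsto_ae
  filter_upwards [hns, ae_all_iff.2 hu] with ω h1 h2
  exact (F ω).body.isCompact.isClosed.mem_of_tendsto h1 (Filter.Eventually.of_forall fun i => h2 _)

theorem norm_le_of_mem_lpSelections {mΩ : MeasurableSpace Ω} {μ : Measure Ω}
    [IsProbabilityMeasure μ] {F : Ω → KcB d B} {f : Lp (Euc d) 2 μ} (hf : f ∈ lpSelections μ F) :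
    ‖f‖ ≤ B := by
  have h := Lp.norm_le_of_ae_bound (f := f) B.2
    (Filter.Eventually.mono hf fun ω hω => (F ω).2 _ hω)
  simpa [measureUnivNNReal] using h

theorem exists_condExp_eq_of_mem_carrier {m mΩ : MeasurableSpace Ω} (hm : m ≤ mΩ) {μ : Measure Ω}
    [IsProbabilityMeasure μ] {F G : Ω → KcB d B} (hF : Measurable F) (hG : Measurable G)
    (hs : ∀ p, (fun ω => supportFun p (G ω).body) =ᵐ[μ] μ[fun ω => supportFun p (F ω).body | m])
    {g : Ω → Euc d} (hg : Measurable[m] g) (hgG : ∀ᵐ ω ∂μ, g ω ∈ (G ω).carrier) :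
    ∃ f ∈ integrableSelections mΩ μ F, g =ᵐ[μ] μ[f | m] := by
  have hgLp : MemLp g 2 μ :=
    memLp_of_ae_mem (hg.mono hm le_rfl).aestronglyMeasurable hgG 2
  have hproj {x : Ω → Euc d} (hx : Measurable x) : Measurable fun ω => (F ω).proj (x ω) :=
    KcB.measurable_uncurry_proj.comp (hx.prodMk hF)
  have hprojF (x : Ω → Euc d) : ∀ᵐ ω ∂μ, (F ω).proj (x ω) ∈ (F ω).carrier :=
    Filter.Eventually.of_forall fun ω => (F ω).proj_mem _
  have hprojLp {x : Ω → Euc d} (hx : Measurable x) : MemLp (fun ω => (F ω).proj (x ω)) 2 μ :=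
    memLp_of_ae_mem (hproj hx).aestronglyMeasurable (hprojF x) 2
  have hmem {x : Ω → Euc d} (hx : Measurable x) : (hprojLp hx).toLp _ ∈ lpSelections μ F :=
    (hprojLp hx).coeFn_toLp.mono fun ω hω => by rw [hω]; exact (F ω).proj_mem _
  let T : Lp (Euc d) 2 μ →L[ℝ] Lp (Euc d) 2 μ :=
    (lpMeas (Euc d) ℝ m 2 μ).subtypeL.comp (condExpL2 (Euc d) ℝ hm)
  -- The projection of 0 onto `F` shows that square integrable selections exist.
  obtain ⟨f₀, hf₀, hmin⟩ := exists_nearest_in_image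
    ⟨_, hmem (measurable_const (a := (0 : Euc d)))⟩ (isClosed_lpSelections μ F)
    (convex_lpSelections μ F) (fun f => norm_le_of_mem_lpSelections) T (hgLp.toLp g)
  -- an `m`-measurable version of the residual
  have hTm : AEStronglyMeasurable[m] (T f₀) μ := lpMeas.aestronglyMeasurable (condExpL2 _ ℝ hm f₀)
  set r : Lp (Euc d) 2 μ := hgLp.toLp g - T f₀ with hr
  have hrm : AEStronglyMeasurable[m] r μ :=
    (((hg.stronglyMeasurable).aestronglyMeasurable.congr hgLp.coeFn_toLp.symm).sub hTm).congr
      (Lp.coeFn_sub _ _).symm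
  obtain ⟨h, hhm, hrh⟩ := hrm
  have hhmeas : Measurable h := hhm.measurable.mono hm le_rfl
  have hhi : Integrable h μ := ((Lp.memLp r).integrable one_le_two).congr hrh
  -- Conditional expectation is the orthogonal projection onto m-measurable functions, and `r` is
  -- one of them.
  have hadj (f : Lp (Euc d) 2 μ) : inner ℝ r (T f) = inner ℝ r f := by
    rw [real_inner_comm, real_inner_comm f]
    exact inner_condExpL2_eq_inner_fun hm f r ⟨h, hhm, hrh⟩
  have hinner (f : Lp (Euc d) 2 μ) {f' : Ω → Euc d} (hf : f =ᵐ[μ] f') :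
      inner ℝ r f = ∫ ω, inner ℝ (h ω) (f' ω) ∂μ := by
    rw [L2.inner_def]
    refine integral_congr_ae ?_
    filter_upwards [hrh, hf] with ω h1 h2
    rw [h1, h2]
  have hinnerInt {f : Ω → Euc d} (hf : AEStronglyMeasurable f μ) (K : Ω → KcB d B)
      (hK : ∀ᵐ ω ∂μ, f ω ∈ (K ω).carrier) : Integrable (fun ω => inner ℝ (h ω) (f ω)) μ :=
    (hhi.norm.mul_const (B : ℝ)).mono' (hhi.aestronglyMeasurable.inner hf) <|
      hK.mono fun ω hω => (norm_inner_le_norm _ _).trans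
        (mul_le_mul_of_nonneg_left ((K ω).2 _ hω) (norm_nonneg _))
  have hFint : Integrable (fun ω => supportFun (h ω) (F ω).body) μ :=
    (hhi.norm.mul_const (B : ℝ)).mono'
      (measurable_uncurry_supportFun.comp (hhmeas.prodMk hF)).aestronglyMeasurable
      (Filter.Eventually.of_forall fun ω => abs_supportFun_le _ _)
  -- Optimality of `f₀` is tested against the projections of (n + 1) • h onto `F`, which maximize
  -- ⟨h, ·⟩ up to B² / (n + 1).
  have hFr : ∫ ω, supportFun (h ω) (F ω).body ∂μ ≤ inner ℝ r (T f₀) := by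
    have hlim : Filter.Tendsto (fun n : ℕ => inner ℝ r (T f₀) + (B : ℝ) ^ 2 *
        (1 / ((n : ℝ) + 1))) Filter.atTop (nhds (inner ℝ r (T f₀) + (B : ℝ) ^ 2 * 0)) :=
      tendsto_const_nhds.add (tendsto_one_div_add_atTop_nhds_zero_nat.const_mul _)
    rw [mul_zero, add_zero] at hlim
    refine ge_of_tendsto' hlim fun n => ?_
    have hn : (0 : ℝ) < (n : ℝ) + 1 := by positivity
    have hx : Measurable fun ω => ((n : ℝ) + 1) • h ω := hhmeas.const_smul ((n : ℝ) + 1)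
    have h1 := hmin _ (hmem hx)
    rw [inner_sub_right, hadj, hinner _ (hprojLp hx).coeFn_toLp] at h1
    have h2 := integral_mono hFint ((hinnerInt (hproj hx).aestronglyMeasurable F (hprojF _)).add
      (integrable_const ((B : ℝ) ^ 2 / ((n : ℝ) + 1))))
      fun ω => supportFun_le_inner_proj (h ω) (F ω) hn
    simp only [Pi.add_apply] at h2
    rw [integral_add (hinnerInt (hproj hx).aestronglyMeasurable F (hprojF _))
      (integrable_const _), integral_const, probReal_univ, one_smul] at h2
    rw [mul_one_div]
    linarith
  -- Conditioning on `m` is conditioning on the identity viewed as a map into (Ω, m), of which `h`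
  -- is a measurable function.
  have hFG : ∫ ω, supportFun (h ω) (F ω).body ∂μ = ∫ ω, supportFun (h ω) (G ω).body ∂μ :=
    integral_supportFun_comp (mβ := m) (X := id) μ (measurable_id'' hm) hF
      (by simpa only [MeasurableSpace.comap_id] using hs) hhm.measurable hhi
  have hgG_le : ∫ ω, inner ℝ (h ω) (g ω) ∂μ ≤ ∫ ω, supportFun (h ω) (G ω).body ∂μ := by
    refine integral_mono_ae (hinnerInt (hg.mono hm le_rfl).aestronglyMeasurable G hgG) ?_
      (hgG.mono fun ω hω => inner_le_supportFun _ _ hω)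
    exact (hhi.norm.mul_const (B : ℝ)).mono'
      (measurable_uncurry_supportFun.comp (hhmeas.prodMk hG)).aestronglyMeasurable
      (Filter.Eventually.of_forall fun ω => abs_supportFun_le _ _)
  -- ‖r‖² = ⟨r, g⟩ - ⟨r, T f₀⟩ ≤ E[s(h, G)] - E[s(h, F)] = 0.
  have hr0 : inner ℝ r r ≤ 0 := by
    nth_rewrite 2 [hr]
    rw [inner_sub_right, hinner _ hgLp.coeFn_toLp]
    linarith
  have hgT : hgLp.toLp g = T f₀ := sub_eq_zero.1 (real_inner_self_nonpos.1 hr0)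
  refine ⟨f₀, ⟨(Lp.stronglyMeasurable f₀).measurable, (Lp.memLp f₀).integrable one_le_two, hf₀⟩, ?_⟩
  have hcond := (Lp.memLp f₀).condExpL2_ae_eq_condExp (𝕜 := ℝ) hm
  rw [Lp.toLp_coeFn] at hcond
  refine hgLp.coeFn_toLp.symm.trans ?_
  rw [hgT]
  exact hcond

/-- An arbitrary sub-σ-algebra is allowed so that `⊥` covers the Aumann mean and `sigmaX X` the
conditional one. -/
theorem integrableSelections_eq {m mΩ : MeasurableSpace Ω} (hm : m ≤ mΩ) (μ : Measure Ω)
    [IsProbabilityMeasure μ] {F G : Ω → KcB d B} (hF : Measurable F) (hG : Measurable G)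
    (hs : ∀ p, (fun ω => supportFun p (G ω).body) =ᵐ[μ] μ[fun ω => supportFun p (F ω).body | m]) :
    integrableSelections m μ G =
      {g | Measurable[m] g ∧ ∃ f ∈ integrableSelections mΩ μ F, g =ᵐ[μ] μ[f | m]} := by
  ext g
  constructor
  · rintro ⟨hg, -, hgG⟩
    exact ⟨hg, exists_condExp_eq_of_mem_carrier hm hF hG hs hg hgG⟩
  · rintro ⟨hg, f, ⟨-, hfi, hfF⟩, hgf⟩
    refine ⟨hg, integrable_condExp.congr hgf.symm, ?_⟩
    filter_upwards [hgf, condExp_mem_carrier hF hs hfi hfF] with ω h1 h2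
    rwa [h1]

end Conditional

/-! ### Fréchet means in terms of support functions -/

section FrechetMean

variable {Ω : Type*} {d : ℕ} {B : ℝ≥0}

theorem isFrechetMean_iff {mΩ : MeasurableSpace Ω} (μ : Measure Ω) [IsProbabilityMeasure μ]
    {F : Ω → KcB d B} (hF : Measurable F) (ν : KcB d B) :
    IsFrechetMean μ F ν ↔ ∀ p, supportFun p ν.body = ∫ ω, supportFun p (F ω).body ∂μ := by
  have : IsProbabilityMeasure (μ.map F) := Measure.isProbabilityMeasure_map hF.aemeasurable
  have hmap : frechetFun μ F = fun ν' : KcB d B => ∫ K, dkc ν'.body K.body ^ 2 ∂(μ.map F) := by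
    funext ν'
    exact (integral_map hF.aemeasurable (measurable_dkc_sq ν').aestronglyMeasurable).symm
  rw [IsFrechetMean, hmap, isMinOn_integral_dkc_sq_iff]
  have hmean (p : Euc d) : supportFun p (meanBody (μ.map F)).body =
      ∫ ω, supportFun p (F ω).body ∂μ := by
    rw [supportFun_meanBody]
    exact integral_map hF.aemeasurable (measurable_supportFun p).aestronglyMeasurable
  constructor
  · rintro rfl p
    exact hmean p
  · exact fun h => KcB.ext_supportFun fun p => (h p).trans (hmean p).symm

theorem existsUnique_isFrechetMean {mΩ : MeasurableSpace Ω} (μ : Measure Ω)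
    [IsProbabilityMeasure μ] {F : Ω → KcB d B} (hF : Measurable F) :
    ∃! ν : KcB d B, IsFrechetMean μ F ν := by
  have : IsProbabilityMeasure (μ.map F) := Measure.isProbabilityMeasure_map hF.aemeasurable
  refine ⟨meanBody (μ.map F), (isFrechetMean_iff μ hF _).2 fun p => ?_, fun ν hν => ?_⟩
  · rw [supportFun_meanBody]
    exact integral_map hF.aemeasurable (measurable_supportFun p).aestronglyMeasurable
  · refine KcB.ext_supportFun fun p => ((isFrechetMean_iff μ hF ν).1 hν p).trans ?_
    rw [supportFun_meanBody]
    exact (integral_map hF.aemeasurable (measurable_supportFun p).aestronglyMeasurable).symm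

/-- This is the case of the trivial σ-algebra: points of `ν` are its constant selections, and
conditional expectations are constant integrals. -/
theorem IsFrechetMean.carrier_eq_aumannMean {mΩ : MeasurableSpace Ω} {μ : Measure Ω}
    [IsProbabilityMeasure μ] {F : Ω → KcB d B} (hF : Measurable F) {ν : KcB d B}
    (hν : IsFrechetMean μ F ν) : ν.carrier = aumannMean μ F := by
  have hsel := integrableSelections_eq bot_le μ (G := fun _ => ν) hF measurable_const fun p => by
    rw [condExp_bot, (isFrechetMean_iff μ hF ν).1 hν p]
  ext x
  have hx : x ∈ ν.carrier ↔ (fun _ => x) ∈ integrableSelections ⊥ μ fun _ : Ω => ν := by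
    refine ⟨fun h => ⟨@measurable_const _ _ _ ⊥ x, integrable_const x,
      Filter.Eventually.of_forall fun _ => h⟩, fun h => ?_⟩
    obtain ⟨_, hω⟩ := h.2.2.exists
    exact hω
  rw [hx, hsel]
  constructor
  · rintro ⟨-, f, hf, hfe⟩
    rw [condExp_bot] at hfe
    obtain ⟨_, hω⟩ := hfe.exists
    exact ⟨f, hf, hω⟩
  · rintro ⟨f, hf, rfl⟩
    refine ⟨@measurable_const _ _ _ ⊥ _, f, hf, ?_⟩
    rw [condExp_bot]

variable {𝒳 : Type*} [MeasurableSpace 𝒳] {mΩ : MeasurableSpace Ω} {μ : Measure Ω}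
  [IsProbabilityMeasure μ]

theorem isMinOn_condFrechetFun_iff (F : Ω → KcB d B) (X : Ω → 𝒳) (ω : Ω) (ν : KcB d B) :
    IsMinOn (fun ν' => condFrechetFun μ F X ν' ω) Set.univ ν ↔
      ν = meanBody (condDistrib F X μ (X ω)) :=
  isMinOn_integral_dkc_sq_iff _ ν

theorem isCondFrechetMean_meanBody (F : Ω → KcB d B) (X : Ω → 𝒳) :
    IsCondFrechetMean μ F X fun ω => meanBody (condDistrib F X μ (X ω)) := by
  have hN : Measurable fun x => meanBody (condDistrib F X μ x) := by
    refine KcB.measurable_of_supportFun fun p => ?_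
    simp only [supportFun_meanBody]
    exact ((measurable_supportFun p).stronglyMeasurable.integral_kernel
      (κ := condDistrib F X μ)).measurable
  exact ⟨hN.comp (comap_measurable X), Filter.Eventually.of_forall fun ω =>
    (isMinOn_condFrechetFun_iff F X ω _).2 rfl⟩

/-- Minimality becomes a linear condition on support functions, the form needed for selections and
for the tower property. -/
theorem IsCondFrechetMean.supportFun_ae_eq {F G : Ω → KcB d B} {X : Ω → 𝒳} (hX : Measurable X)
    (hF : Measurable F) (hG : IsCondFrechetMean μ F X G) (p : Euc d) :
    (fun ω => supportFun p (G ω).body) =ᵐ[μ] μ[fun ω => supportFun p (F ω).body | sigmaX X] := by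
  filter_upwards [hG.2, condExp_ae_eq_integral_condDistrib hX hF.aemeasurable
    (measurable_supportFun p).stronglyMeasurable (integrable_supportFun μ hF p)] with ω h1 h2
  rw [h2, (isMinOn_condFrechetFun_iff F X ω _).1 h1, supportFun_meanBody]

theorem IsCondFrechetMean.isFrechetMean_iff {F G : Ω → KcB d B} {X : Ω → 𝒳} (hX : Measurable X)
    (hF : Measurable F) (hG : IsCondFrechetMean μ F X G) (ν : KcB d B) :
    IsFrechetMean μ F ν ↔ IsFrechetMean μ G ν := by
  have hGm : Measurable G := hG.1.mono hX.comap_le le_rfl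
  have h (p : Euc d) : ∫ ω, supportFun p (G ω).body ∂μ = ∫ ω, supportFun p (F ω).body ∂μ := by
    rw [integral_congr_ae (hG.supportFun_ae_eq hX hF p), integral_condExp hX.comap_le]
  rw [_root_.isFrechetMean_iff μ hF, _root_.isFrechetMean_iff μ hGm]
  simp only [h]

end FrechetMean

theorem proposition2 {Ω : Type*} {mΩ : MeasurableSpace Ω} (μ : Measure Ω) [IsProbabilityMeasure μ]
    (d p : ℕ) (B : ℝ≥0) (hB : 0 < B)
    (𝒳 : Set (Euc p)) (X : Ω → 𝒳) (hX : Measurable X)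
    (F : Ω → KcB d B) (hF : Measurable F) :
    -- existence and uniqueness of the Fréchet mean
    (∃! ν : KcB d B, IsFrechetMean μ F ν) ∧
    -- existence and almost sure uniqueness of the conditional Fréchet mean
    (∃ G : Ω → KcB d B, IsCondFrechetMean μ F X G ∧
      ∀ᵐ ω ∂μ, ∀ ν : KcB d B,
        IsMinOn (fun ν' => condFrechetFun μ F X ν' ω) Set.univ ν → ν = G ω) ∧
    -- the Fréchet mean is the Aumann mean
    (∀ ν : KcB d B, IsFrechetMean μ F ν → ν.carrier = aumannMean μ F) ∧
    -- the conditional Fréchet mean is the conditional Aumann mean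
    (∀ G : Ω → KcB d B, IsCondFrechetMean μ F X G →
      integrableSelections (sigmaX X) μ G = condAumannMean μ F X) ∧
    -- law of iterated expectations
    (∀ G : Ω → KcB d B, IsCondFrechetMean μ F X G →
      ∀ ν : KcB d B, IsFrechetMean μ F ν ↔ IsFrechetMean μ G ν) := by
  have hmin := isCondFrechetMean_meanBody (μ := μ) F X
  -- Uniqueness holds at every `ω`, since each conditional distribution is a probability measure
  -- with its own mean body.
  refine ⟨existsUnique_isFrechetMean μ hF, ⟨_, hmin, Filter.Eventually.of_forall fun ω ν hν =>
    (isMinOn_condFrechetFun_iff F X ω ν).1 hν⟩, fun ν hν => hν.carrier_eq_aumannMean hF,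
    fun G hG => ?_, fun G hG => hG.isFrechetMean_iff hX hF⟩
  exact integrableSelections_eq hX.comap_le μ hF (hG.1.mono hX.comap_le le_rfl)
    (hG.supportFun_ae_eq hX hF)
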